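/- Let $d\ge 1$, let $\{|x\rangle\}_{x=1}^d$ be an orthonormal basis of $\mathbb C^d$, let $\varepsilon\in(0,1)$, and let $\mathcal M_d=\{M_x\}_{x=1}^d$ with $$M_x=(1-\varepsilon)\,|x\rangle\langle x|+\frac{\varepsilon}{d}\,\mathbb 1$$ be the noisy projective measurement. For a measurement (POVM) $\mathcal M=\{M_x\}_x$ on $\mathbb C^d$ and a unit vector $|\phi\rangle\in\mathbb C^d$, let $$P_{\mathrm{guess}}(|\phi\rangle,\mathcal M)=\max_{\{K_{x,j}\}}\ \sum_j\langle\phi|K_{j,j}|\phi\rangle ,$$ where $x$ and $j$ run over the outcomes of $\mathcal M$ and the maximum is over all families of $d\times d$ matrices $K_{x,j}\ge 0$ with $\sum_x d\,K_{x,j}=\mathbb 1\sum_x\operatorname{tr}K_{x,j}$ for all $j$ and $\sum_j K_{x,j}=M_x$ for all $x$, and let $P^*_{\mathrm{guess}}(\mathcal M)=\min_{|\phi\rangle}P_{\mathrm{guess}}(|\phi\rangle,\mathcal M)$, the minimum being over all unit vectors $|\phi\rangle$. Then, for $\mathcal M=\mathcal M_d$, the maxima and the minimum exist, and $$P^*_{\mathrm{guess}}(\mathcal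 M_d)=\frac1d\left(\operatorname{tr}\sqrt{M_k}\right)^2\qquad\text{for every } k=1,\dots,d$$ (in particular for $k=1$). The minimum is attained at the uniform superposition state $|\psi\rangle=\frac1{\sqrt d}\sum_x|x\rangle$. -/

import Mathlib

open scoped MatrixOrder ComplexOrder

noncomputable section

/-- A quantum measurement (POVM) with outcomes in `ι`, acting on the Hilbert space `ℂⁿ`: positive
semidefinite matrices that sum to the identity. -/
structure POVM (ι n : Type*) [Fintype ι] [Fintype n] [DecidableEq n] where
  /-- the element of the measurement that belongs to the outcome `x` -/
  elem : ι → Matrix n n ℂ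
  posSemidef : ∀ x, (elem x).PosSemidef
  sum_eq_one : ∑ x, elem x = 1

/-- The operator `|u⟩⟨u|`. -/
def ketbra {n : Type*} (u : EuclideanSpace ℂ n) : Matrix n n ℂ :=
  Matrix.vecMulVec u.ofLp (star u.ofLp)

/-- The number `⟨φ|K|φ⟩` (its real part, which is all of it for a Hermitian `K`). -/
def expectation {n : Type*} [Fintype n] (φ : EuclideanSpace ℂ n) (K : Matrix n n ℂ) : ℝ :=
  (star φ.ofLp ⬝ᵥ K.mulVec φ.ofLp).re

/-- `K` is a decomposition of the measurement `M` into subnormalized POVMs `K_j = {K_{x,j}}_x`, one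
for each guess `j` of the eavesdropper: `K_{x,j} ≥ 0`, `d ∑_x K_{x,j} = 𝟙 ∑_x tr K_{x,j}` for all
`j`, and `∑_j K_{x,j} = M_x` for all `x`. Here `K x j` is `K_{x,j}`. -/
structure IsDecomposition {ι n : Type*} [Fintype ι] [Fintype n] [DecidableEq n]
    (M : POVM ι n) (K : ι → ι → Matrix n n ℂ) : Prop where
  posSemidef : ∀ x j, (K x j).PosSemidef
  subnormalized : ∀ j, ∑ x, (Fintype.card n : ℂ) • K x j =
    (∑ x, (K x j).trace) • (1 : Matrix n n ℂ)
  sum_eq : ∀ x, ∑ j, K x j = M.elem x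

/-- The guessing probabilities `∑_j ⟨φ|K_{j,j}|φ⟩` that the eavesdropper reaches with the
decompositions of `M`, when the state `φ` is measured. -/
def guessValues {ι n : Type*} [Fintype ι] [Fintype n] [DecidableEq n]
    (φ : EuclideanSpace ℂ n) (M : POVM ι n) : Set ℝ :=
  {p | ∃ K, IsDecomposition M K ∧ p = ∑ j, expectation φ (K j j)}

/-- The guessing probability `P_guess(φ, M)`: the maximum over all decompositions. -/
def pGuess {ι n : Type*} [Fintype ι] [Fintype n] [DecidableEq n]
    (φ : EuclideanSpace ℂ n) (M : POVM ι n) : ℝ :=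
  sSup (guessValues φ M)

/-- The guessing probabilities of the pure states, that is, of the unit vectors. -/
def stateGuessValues {ι n : Type*} [Fintype ι] [Fintype n] [DecidableEq n]
    (M : POVM ι n) : Set ℝ :=
  {p | ∃ φ : EuclideanSpace ℂ n, ‖φ‖ = 1 ∧ p = pGuess φ M}

/-- The optimal guessing probability `P*_guess(M)`: the minimum of `P_guess(φ, M)` over all pure
states `φ`. -/
def pGuessStar {ι n : Type*} [Fintype ι] [Fintype n] [DecidableEq n]
    (M : POVM ι n) : ℝ :=
  sInf (stateGuessValues M)

/-- The depolarizing channel `σ ↦ (1 - ε) σ + (ε / d) tr(σ) 𝟙` in dimension `d`. -/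
def depolarize {n : Type*} [Fintype n] [DecidableEq n] (ε : ℝ) (σ : Matrix n n ℂ) :
    Matrix n n ℂ :=
  ((1 - ε : ℝ) : ℂ) • σ + (((ε / Fintype.card n : ℝ) : ℂ) * σ.trace) • (1 : Matrix n n ℂ)

theorem ketbra_posSemidef {n : Type*} [Fintype n] (u : EuclideanSpace ℂ n) :
    (ketbra u).PosSemidef :=
  Matrix.posSemidef_vecMulVec_self_star u.ofLp

theorem trace_ketbra {n : Type*} [Fintype n] (u : EuclideanSpace ℂ n) :
    (ketbra u).trace = ((‖u‖ ^ 2 : ℝ) : ℂ) := by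
  rw [ketbra, Matrix.trace_vecMulVec, ← EuclideanSpace.inner_eq_star_dotProduct,
    inner_self_eq_norm_sq_to_K]
  norm_cast

theorem sum_ketbra {d : ℕ} (b : OrthonormalBasis (Fin d) ℂ (EuclideanSpace ℂ (Fin d))) :
    ∑ x, ketbra (b x) = 1 := by
  let U : Matrix (Fin d) (Fin d) ℂ := fun i x => (b x).ofLp i
  have h1 : U.conjTranspose * U = 1 := by
    ext x y
    have h := orthonormal_iff_ite.1 b.orthonormal x y
    rw [EuclideanSpace.inner_eq_star_dotProduct] at h
    rw [Matrix.one_apply, ← h, Matrix.mul_apply, dotProduct]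
    exact Finset.sum_congr rfl fun i _ => mul_comm _ _
  rw [← mul_eq_one_comm.1 h1]
  ext i j
  rw [Matrix.mul_apply, Matrix.sum_apply]
  exact Finset.sum_congr rfl fun _ _ => rfl

/-- The noisy projective measurement in dimension `d`, with elements
`M_x = (1 - ε) |x⟩⟨x| + (ε / d) 𝟙`, for an orthonormal basis `{|x⟩}`. -/
def noisyProjective {d : ℕ} (b : OrthonormalBasis (Fin d) ℂ (EuclideanSpace ℂ (Fin d)))
    (ε : ℝ) (hε : ε ∈ Set.Ioo (0 : ℝ) 1) : POVM (Fin d) (Fin d) where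
  elem x := depolarize ε (ketbra (b x))
  posSemidef x := by
    have h1 : (0 : ℂ) ≤ ((1 - ε : ℝ) : ℂ) := by exact_mod_cast (sub_pos.2 hε.2).le
    have h2 : (0 : ℂ) ≤ ((ε / Fintype.card (Fin d) : ℝ) : ℂ) := by
      exact_mod_cast div_nonneg hε.1.le (Nat.cast_nonneg _)
    have h3 : (0 : ℂ) ≤ (ketbra (b x)).trace := (ketbra_posSemidef (b x)).trace_nonneg
    exact ((ketbra_posSemidef (b x)).smul h1).add (Matrix.PosSemidef.one.smul (mul_nonneg h2 h3))
  sum_eq_one := by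
    rcases Nat.eq_zero_or_pos d with rfl | hd
    · exact Subsingleton.elim _ _
    have hd' : (d : ℂ) ≠ 0 := by exact_mod_cast hd.ne'
    simp only [depolarize, Finset.sum_add_distrib, ← Finset.smul_sum, sum_ketbra, trace_ketbra,
      b.orthonormal.1]
    ext i j
    simp [Matrix.natCast_apply, Matrix.one_apply]
    field_simp
    split_ifs <;> ring

/-- The uniform superposition `d^{-1/2} ∑_x |x⟩` of the basis vectors. -/
def uniformState {d : ℕ} (b : OrthonormalBasis (Fin d) ℂ (EuclideanSpace ℂ (Fin d))) :
    EuclideanSpace ℂ (Fin d) :=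
  (((Real.sqrt d)⁻¹ : ℝ) : ℂ) • ∑ x, b x

end

/-!
The square root of `M_j = (1 - ε) |j⟩⟨j| + (ε / d) 𝟙` is `S_j = s 𝟙 + (a - s) |j⟩⟨j|`, where
`a² = 1 - ε + ε / d` and `s² = ε / d`. Hence `tr S_j = a + (d - 1) s`, and this is also the value of
`∑_j ⟨φ|S_j|φ⟩` for every unit vector `φ`. By the Cauchy-Schwarz inequality `∑_j ⟨φ|S_j|φ⟩²` is at
least `(tr S_k)² / d`.

For the lower bound, an eavesdropper can reach at least `∑_j ⟨φ|S_j|φ⟩²` for each `φ`: there is a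
decomposition with `K_{j,j} ≥ S_j |φ⟩⟨φ| S_j` (`isDecomposition_guessDecomposition`). Its other
members are `K_{x,j} = |w_{x,j}⟩⟨w_{x,j}|`, where `w_{x,j} = a ⟨φ|j⟩ |x⟩ - s ⟨φ|x⟩ |j⟩` lives on
the span of two basis vectors only. The cross terms of `K_{x,j}` cancel those of `K_{j,j}` in the
sum over `x`, and those of `K_{x,x}` in the sum over `j`. What is left to choose is diagonal, and
`K_{j,j} - S_j |φ⟩⟨φ| S_j` becomes `s²` times `‖r‖² (𝟙 - |j⟩⟨j|) - |r⟩⟨r|`, with `r` the component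
of `φ` orthogonal to `|j⟩`; this is positive semidefinite
(`posSemidef_norm_sq_smul_one_sub_ketbra`).

For the upper bound at the uniform superposition (`guessValue_uniformState_le`), only the
consequences `K_{j,j} ≤ p_j 𝟙`, with `∑_j p_j = 1`, and `K_{j,j} ≤ M_j` are used: a suitable
multiple of the state is split into two vectors, one for each of these two inequalities, and the
weighted triangle inequality `expectation_add_le` for the form of `K_{j,j}` recombines them.

The maximum over the decompositions is attained because they form a compact set.
-/

/-! ### Rank-one operators -/

section Outer

open Matrix

variable {n : Type*}

/-- The operator `|u⟩⟨v|`. -/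
def outer (u v : EuclideanSpace ℂ n) : Matrix n n ℂ :=
  vecMulVec u.ofLp (star v.ofLp)

theorem ketbra_eq_outer (u : EuclideanSpace ℂ n) : ketbra u = outer u u := rfl

theorem outer_add_left (u u' v : EuclideanSpace ℂ n) :
    outer (u + u') v = outer u v + outer u' v := by
  simp [outer, add_vecMulVec]

theorem outer_add_right (u v v' : EuclideanSpace ℂ n) :
    outer u (v + v') = outer u v + outer u v' := by
  simp [outer, vecMulVec_add]

theorem outer_sub_left (u u' v : EuclideanSpace ℂ n) :
    outer (u - u') v = outer u v - outer u' v := by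
  simp [outer, sub_vecMulVec]

theorem outer_sub_right (u v v' : EuclideanSpace ℂ n) :
    outer u (v - v') = outer u v - outer u v' := by
  simp [outer, vecMulVec_sub]

theorem outer_smul_left (c : ℂ) (u v : EuclideanSpace ℂ n) :
    outer (c • u) v = c • outer u v := by
  simp [outer, smul_vecMulVec]

theorem outer_smul_right (c : ℂ) (u v : EuclideanSpace ℂ n) :
    outer u (c • v) = star c • outer u v := by
  simp [outer, vecMulVec_smul]

theorem outer_sum_left {ι : Type*} (s : Finset ι) (f : ι → EuclideanSpace ℂ n)
    (v : EuclideanSpace ℂ n) : outer (∑ x ∈ s, f x) v = ∑ x ∈ s, outer (f x) v := by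
  ext p q
  simp [outer, vecMulVec_apply, Matrix.sum_apply, Finset.sum_mul]

theorem outer_sum_right {ι : Type*} (s : Finset ι) (f : ι → EuclideanSpace ℂ n)
    (u : EuclideanSpace ℂ n) : outer u (∑ x ∈ s, f x) = ∑ x ∈ s, outer u (f x) := by
  ext p q
  simp [outer, vecMulVec_apply, Matrix.sum_apply, Finset.mul_sum]

variable [Fintype n]

theorem outer_mul_outer (u v w z : EuclideanSpace ℂ n) :
    outer u v * outer w z = inner ℂ v w • outer u z := by
  rw [outer, outer, vecMulVec_mul_vecMulVec, EuclideanSpace.inner_eq_star_dotProduct, outer,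
    dotProduct_comm, vecMulVec_smul]

theorem dotProduct_outer_mulVec (v u w : EuclideanSpace ℂ n) :
    star v.ofLp ⬝ᵥ outer u w *ᵥ v.ofLp = inner ℂ v u * inner ℂ w v := by
  rw [outer, vecMulVec_mulVec, EuclideanSpace.inner_eq_star_dotProduct,
    EuclideanSpace.inner_eq_star_dotProduct, dotProduct_comm v.ofLp]
  simp [dotProduct_smul, dotProduct_comm, mul_comm]

theorem inner_mul_inner_comm (u v : EuclideanSpace ℂ n) :
    inner ℂ u v * inner ℂ v u = ((‖inner ℂ v u‖ ^ 2 : ℝ) : ℂ) := by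
  rw [← inner_conj_symm u v, ← Complex.normSq_eq_conj_mul_self, Complex.normSq_eq_norm_sq]

theorem dotProduct_self_eq_norm_sq (v : EuclideanSpace ℂ n) :
    star v.ofLp ⬝ᵥ v.ofLp = ((‖v‖ ^ 2 : ℝ) : ℂ) := by
  rw [dotProduct_comm, ← EuclideanSpace.inner_eq_star_dotProduct, inner_self_eq_norm_sq_to_K]
  norm_cast

end Outer

/-! ### Quadratic forms -/

section Expectation

open Matrix

variable {n : Type*} [Fintype n]

theorem expectation_add (φ : EuclideanSpace ℂ n) (K L : Matrix n n ℂ) :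
    expectation φ (K + L) = expectation φ K + expectation φ L := by
  simp [expectation, add_mulVec, dotProduct_add]

theorem expectation_sub (φ : EuclideanSpace ℂ n) (K L : Matrix n n ℂ) :
    expectation φ (K - L) = expectation φ K - expectation φ L := by
  simp [expectation, sub_mulVec, dotProduct_sub]

theorem expectation_smul (φ : EuclideanSpace ℂ n) (r : ℝ) (K : Matrix n n ℂ) :
    expectation φ ((r : ℂ) • K) = r * expectation φ K := by
  simp [expectation, smul_mulVec, dotProduct_smul]

theorem expectation_one [DecidableEq n] (φ : EuclideanSpace ℂ n) :
    expectation φ 1 = ‖φ‖ ^ 2 := by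
  rw [expectation, one_mulVec, dotProduct_self_eq_norm_sq, Complex.ofReal_re]

/-- For a unit vector `e` and `r ⟂ e`, the projection onto `e^⟂`, scaled by `‖r‖²`, dominates
`|r⟩⟨r|`. This is the Cauchy-Schwarz inequality on `e^⟂`. -/
theorem posSemidef_norm_sq_smul_one_sub_ketbra [DecidableEq n]
    (e r : EuclideanSpace ℂ n) (he : ‖e‖ = 1) (her : inner ℂ e r = 0) :
    (((‖r‖ ^ 2 : ℝ) : ℂ) • (1 - ketbra e) - ketbra r).PosSemidef := by
  refine PosSemidef.of_dotProduct_mulVec_nonneg ?_ fun y => ?_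
  · have h1 := (PosSemidef.one (n := n) (R := ℂ)).isHermitian
    refine IsHermitian.sub ?_ (ketbra_posSemidef r).isHermitian
    rw [IsHermitian, conjTranspose_smul, conjTranspose_sub, h1.eq,
      (ketbra_posSemidef e).isHermitian.eq]
    simp
  · obtain ⟨v, rfl⟩ : ∃ v : EuclideanSpace ℂ n, v.ofLp = y := ⟨WithLp.toLp 2 y, rfl⟩
    have hreal : ∀ u : EuclideanSpace ℂ n,
        star v.ofLp ⬝ᵥ ketbra u *ᵥ v.ofLp = ((‖inner ℂ u v‖ ^ 2 : ℝ) : ℂ) := fun u => by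
      rw [ketbra_eq_outer, dotProduct_outer_mulVec, inner_mul_inner_comm]
    rw [sub_mulVec, smul_mulVec, sub_mulVec, one_mulVec, dotProduct_sub, dotProduct_smul,
      dotProduct_sub, dotProduct_self_eq_norm_sq, hreal, hreal, smul_eq_mul]
    -- Cauchy-Schwarz for `r` and the component of `v` orthogonal to `e`
    set w := v - inner ℂ e v • e with hw
    have hrw : inner ℂ r v = inner ℂ r w := by
      rw [hw, inner_sub_right, inner_smul_right, inner_eq_zero_symm.1 her, mul_zero, sub_zero]
    have hew : inner ℂ e w = 0 := by
      rw [hw, inner_sub_right, inner_smul_right, inner_self_eq_norm_sq_to_K, he]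
      simp
    have hnw : ‖v‖ ^ 2 = ‖inner ℂ e v‖ ^ 2 + ‖w‖ ^ 2 := by
      have hv : v = inner ℂ e v • e + w := by simp [hw]
      have := norm_add_sq_eq_norm_sq_add_norm_sq_of_inner_eq_zero (𝕜 := ℂ)
        (inner ℂ e v • e) w (by rw [inner_smul_left, hew, mul_zero])
      rw [← hv, norm_smul, he, mul_one] at this
      linarith [sq ‖v‖, sq ‖w‖, sq ‖(inner ℂ e v : ℂ)‖]
    have hcs := norm_inner_le_norm (𝕜 := ℂ) r w
    have : 0 ≤ ‖r‖ ^ 2 * (‖v‖ ^ 2 - ‖inner ℂ e v‖ ^ 2) - ‖inner ℂ r v‖ ^ 2 := by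
      rw [hrw, hnw, add_sub_cancel_left, ← mul_pow, sub_nonneg]
      gcongr
    exact_mod_cast this

theorem expectation_ketbra (φ u : EuclideanSpace ℂ n) :
    expectation φ (ketbra u) = ‖inner ℂ u φ‖ ^ 2 := by
  rw [ketbra_eq_outer, expectation, dotProduct_outer_mulVec, inner_mul_inner_comm,
    Complex.ofReal_re]

theorem expectation_nonneg (φ : EuclideanSpace ℂ n) {K : Matrix n n ℂ} (hK : K.PosSemidef) :
    0 ≤ expectation φ K :=
  (Complex.le_def.1 (hK.dotProduct_mulVec_nonneg φ.ofLp)).1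

theorem expectation_smul_left (r : ℝ) (φ : EuclideanSpace ℂ n) (K : Matrix n n ℂ) :
    expectation ((r : ℂ) • φ) K = r ^ 2 * expectation φ K := by
  simp [expectation, mulVec_smul, dotProduct_smul, smul_dotProduct]
  ring

/-- A weighted triangle inequality for the quadratic form of a positive semidefinite matrix; the
difference of the two sides is `⟨τ e - g|K|τ e - g⟩`. -/
theorem expectation_add_le (e g : EuclideanSpace ℂ n) {K : Matrix n n ℂ} (hK : K.PosSemidef)
    (τ : ℝ) :
    τ * expectation (e + g) K ≤
      τ * (1 + τ) * expectation e K + (1 + τ) * expectation g K := by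
  have h := expectation_nonneg ((τ : ℂ) • e - g) hK
  simp only [expectation, WithLp.ofLp_sub, WithLp.ofLp_add, WithLp.ofLp_smul, star_sub, star_add,
    star_smul, mulVec_sub, mulVec_add, mulVec_smul, sub_dotProduct, dotProduct_sub, add_dotProduct,
    dotProduct_add, smul_dotProduct, dotProduct_smul, smul_eq_mul, Complex.add_re, Complex.sub_re,
    Complex.star_def, Complex.conj_ofReal, Complex.re_ofReal_mul] at h ⊢
  linarith

end Expectation

/-! ### Decompositions of a measurement -/

section Decomposition

open Matrix

variable {ι n : Type*} [Fintype ι] [Fintype n] [DecidableEq n]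

theorem POVM.elem_le_one (M : POVM ι n) (x : ι) : M.elem x ≤ 1 := by
  rw [← M.sum_eq_one]
  exact Finset.single_le_sum (fun y _ => nonneg_iff_posSemidef.2 (M.posSemidef y))
    (Finset.mem_univ x)

namespace IsDecomposition

variable {M : POVM ι n} {K : ι → ι → Matrix n n ℂ}

theorem le_elem (hK : IsDecomposition M K) (x j : ι) : K x j ≤ M.elem x := by
  rw [← hK.sum_eq x]
  exact Finset.single_le_sum (fun y _ => nonneg_iff_posSemidef.2 (hK.posSemidef x y))
    (Finset.mem_univ j)

/-- The weights `p_j`, defined by `∑_x K_{x,j} = p_j 𝟙`, form a probability distribution. -/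
theorem exists_weights [Nonempty n] (hK : IsDecomposition M K) :
    ∃ p : ι → ℝ, (∀ j, ∑ x, K x j = (p j : ℂ) • 1) ∧ ∑ j, p j = 1 := by
  have hd : (Fintype.card n : ℂ) ≠ 0 := by exact_mod_cast Fintype.card_ne_zero
  have htr : ∀ x j, ((K x j).trace.re : ℂ) = (K x j).trace := fun x j =>
    (Complex.eq_re_of_ofReal_le (r := 0) (by simpa using (hK.posSemidef x j).trace_nonneg)).symm
  refine ⟨fun j => (∑ x, (K x j).trace.re) / Fintype.card n, fun j => ?_, ?_⟩
  · have h := hK.subnormalized j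
    rw [← Finset.smul_sum] at h
    rw [← inv_smul_smul₀ hd (∑ x, K x j), h, smul_smul]
    congr 1
    push_cast
    simp_rw [htr]
    rw [div_eq_inv_mul]
  · have h : ∑ x, ∑ j, (K x j).trace = Fintype.card n := by
      rw [← trace_one, ← M.sum_eq_one, trace_sum]
      exact Finset.sum_congr rfl fun x _ => by rw [← hK.sum_eq x, trace_sum]
    rw [← Finset.sum_div, Finset.sum_comm]
    apply Complex.ofReal_injective
    push_cast
    simp_rw [htr]
    rw [h, div_self hd]

end IsDecomposition

open scoped Matrix.Norms.L2Operator in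
theorem isCompact_setOf_isDecomposition (M : POVM ι n) :
    IsCompact {K : ι → ι → Matrix n n ℂ | IsDecomposition M K} := by
  have hentry : ∀ x j, Continuous fun K : ι → ι → Matrix n n ℂ => K x j := fun x j => by fun_prop
  have : ProperSpace (Matrix n n ℂ) := FiniteDimensional.proper ℂ _
  refine Metric.isCompact_of_isClosed_isBounded ?_ ?_
  · have : {K : ι → ι → Matrix n n ℂ | IsDecomposition M K} =
        (⋂ x, ⋂ j, {K | 0 ≤ K x j}) ∩
        ((⋂ j, {K | ∑ x, (Fintype.card n : ℂ) • K x j =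
          (∑ x, (K x j).trace) • (1 : Matrix n n ℂ)}) ∩
        ⋂ x, {K | ∑ j, K x j = M.elem x}) := by
      ext K
      simp only [Set.mem_inter_iff, Set.mem_iInter, Set.mem_ofPred_eq, nonneg_iff_posSemidef]
      exact ⟨fun h => ⟨h.1, h.2, h.3⟩, fun h => ⟨h.1, h.2.1, h.2.2⟩⟩
    rw [this]
    refine (isClosed_iInter fun x => isClosed_iInter fun j => ?_).inter
      ((isClosed_iInter fun j => ?_).inter (isClosed_iInter fun x => ?_))
    · exact isClosed_le continuous_const (hentry x j)
    · refine isClosed_eq ?_ ?_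
      · exact continuous_finsetSum _ fun x _ =>
          (continuous_const_smul (Fintype.card n : ℂ)).comp (hentry x j)
      · exact (continuous_finsetSum _ fun x _ => (hentry x j).matrix_trace).smul
          continuous_const
    · exact isClosed_eq (continuous_finsetSum _ fun j _ => hentry x j) continuous_const
  · refine (Metric.isBounded_closedBall (x := 0) (r := ‖(1 : Matrix n n ℂ)‖)).subset fun K hK => ?_
    rw [mem_closedBall_zero_iff]
    refine (pi_norm_le_iff_of_nonneg (norm_nonneg _)).2 fun x =>
      (pi_norm_le_iff_of_nonneg (norm_nonneg _)).2 fun j => ?_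
    exact CStarAlgebra.norm_le_norm_of_nonneg_of_le
      (nonneg_iff_posSemidef.2 (hK.posSemidef x j)) ((hK.le_elem x j).trans (M.elem_le_one x))

/-- The maximum in the definition of the guessing probability is attained. -/
theorem isGreatest_pGuess (φ : EuclideanSpace ℂ n) {M : POVM ι n}
    (hM : ∃ K, IsDecomposition M K) : IsGreatest (guessValues φ M) (pGuess φ M) := by
  have hcont : Continuous fun K : ι → ι → Matrix n n ℂ => ∑ j, expectation φ (K j j) := by
    unfold expectation
    fun_prop
  have himage : guessValues φ M =
      (fun K : ι → ι → Matrix n n ℂ => ∑ j, expectation φ (K j j)) ''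
        {K | IsDecomposition M K} := by
    ext p
    exact exists_congr fun K => and_congr_right fun _ => eq_comm
  have hcompact : IsCompact (guessValues φ M) :=
    himage ▸ (isCompact_setOf_isDecomposition M).image hcont
  exact hcompact.isGreatest_sSup (himage ▸ Set.Nonempty.image _ hM)

end Decomposition

/-! ### The square root of a noisy projection -/

section NoisyProjective

open Matrix

variable {d : ℕ} (b : OrthonormalBasis (Fin d) ℂ (EuclideanSpace ℂ (Fin d)))

/-- The noisy projection in terms of the eigenvalues `a` and `s` of its square root. -/
theorem noisyProjective_elem {ε : ℝ} (hε : ε ∈ Set.Ioo (0 : ℝ) 1) {a s : ℝ}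
    (hs : s ^ 2 = ε / d) (ha : a ^ 2 = 1 - ε + ε / d) (x : Fin d) :
    (noisyProjective b ε hε).elem x =
      ((a ^ 2 - s ^ 2 : ℝ) : ℂ) • ketbra (b x) +
        ((s ^ 2 : ℝ) : ℂ) • (1 : Matrix (Fin d) (Fin d) ℂ) := by
  have h : a ^ 2 - s ^ 2 = 1 - ε := by rw [hs, ha]; ring
  rw [h, hs]
  simp [noisyProjective, depolarize, trace_ketbra]

theorem sqrt_noisyProjective_elem {ε : ℝ} (hε : ε ∈ Set.Ioo (0 : ℝ) 1) {a s : ℝ}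
    (hs0 : 0 ≤ s) (hsa : s ≤ a) (hs : s ^ 2 = ε / d) (ha : a ^ 2 = 1 - ε + ε / d) (x : Fin d) :
    CFC.sqrt ((noisyProjective b ε hε).elem x) =
      ((a - s : ℝ) : ℂ) • ketbra (b x) + (s : ℂ) • (1 : Matrix (Fin d) (Fin d) ℂ) := by
  refine CFC.sqrt_unique ?_ (nonneg_iff_posSemidef.2 ?_)
  · rw [noisyProjective_elem b hε hs ha]
    have hP : ketbra (b x) * ketbra (b x) = ketbra (b x) := by
      simp [ketbra_eq_outer, outer_mul_outer]
    simp only [add_mul, mul_add, smul_mul_smul, hP, mul_one, one_mul]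
    match_scalars <;> ring
  · exact ((ketbra_posSemidef (b x)).smul (by exact_mod_cast sub_nonneg.2 hsa)).add
      (PosSemidef.one.smul (by exact_mod_cast hs0))

theorem trace_sqrt_noisyProjective_elem {ε : ℝ} (hε : ε ∈ Set.Ioo (0 : ℝ) 1) {a s : ℝ}
    (hs0 : 0 ≤ s) (hsa : s ≤ a) (hs : s ^ 2 = ε / d) (ha : a ^ 2 = 1 - ε + ε / d) (x : Fin d) :
    (CFC.sqrt ((noisyProjective b ε hε).elem x)).trace.re = a + (d - 1) * s := by
  rw [sqrt_noisyProjective_elem b hε hs0 hsa hs ha]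
  simp [trace_ketbra]
  ring

/-! ### A decomposition adapted to a pure state -/

/-- The vector `w_{x,j} = a ⟨φ|j⟩ |x⟩ - s ⟨φ|x⟩ |j⟩`. It is orthogonal to `S_j |φ⟩`, where
`S_j = s 𝟙 + (a - s) |j⟩⟨j|`, for `x ≠ j`. -/
noncomputable def guessVector (a s : ℝ) (φ : EuclideanSpace ℂ (Fin d)) (x j : Fin d) :
    EuclideanSpace ℂ (Fin d) :=
  ((a : ℂ) * inner ℂ φ (b j)) • b x - ((s : ℂ) * inner ℂ φ (b x)) • b j

/-- The Hermitian matrix that has to be added to `|w_{j,j}⟩⟨w_{j,j}|` in order that `∑_x K_{x,j}`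
is a multiple of the identity and `∑_x K_{j,x}` is the `j`-th element of the noisy measurement. It
is not positive semidefinite in general, but the sum `K_{j,j}` is. -/
noncomputable def guessCorrection (a s : ℝ) (φ : EuclideanSpace ℂ (Fin d)) (j : Fin d) :
    Matrix (Fin d) (Fin d) ℂ :=
  ((a * s : ℝ) : ℂ) •
      (inner ℂ (b j) φ • outer (b j) φ + inner ℂ φ (b j) • outer φ (b j)) +
    ((s ^ 2 * (1 - ‖inner ℂ (b j) φ‖ ^ 2) : ℝ) : ℂ) • 1 - ((s ^ 2 : ℝ) : ℂ) • ketbra (b j)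

/-- The eavesdropper's decomposition for the state `φ`: `K_{x,j} = |w_{x,j}⟩⟨w_{x,j}|` for `x ≠ j`,
and the same plus `guessCorrection` for `x = j`. The numbers `a ≥ s` are the eigenvalues of the
square roots of the elements of the noisy measurement. -/
noncomputable def guessDecomposition (a s : ℝ) (φ : EuclideanSpace ℂ (Fin d)) (x j : Fin d) :
    Matrix (Fin d) (Fin d) ℂ :=
  ketbra (guessVector b a s φ x j) + if x = j then guessCorrection b a s φ j else 0

theorem ketbra_guessVector (a s : ℝ) (φ : EuclideanSpace ℂ (Fin d)) (x j : Fin d) :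
    ketbra (guessVector b a s φ x j) =
      ((a ^ 2 * ‖inner ℂ (b j) φ‖ ^ 2 : ℝ) : ℂ) • ketbra (b x)
      + ((s ^ 2 * ‖inner ℂ (b x) φ‖ ^ 2 : ℝ) : ℂ) • ketbra (b j)
      - ((a * s : ℝ) : ℂ) • (inner ℂ φ (b j) * inner ℂ (b x) φ) • outer (b x) (b j)
      - ((a * s : ℝ) : ℂ) • (inner ℂ (b j) φ * inner ℂ φ (b x)) • outer (b j) (b x) := by
  simp only [Complex.ofReal_mul, ← inner_mul_inner_comm, guessVector, ketbra_eq_outer,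
    outer_sub_left, outer_sub_right, outer_smul_left, outer_smul_right, star_mul',
    Complex.star_def, inner_conj_symm, Complex.conj_ofReal]
  match_scalars <;> ring

theorem sum_inner_smul_outer_left (φ u : EuclideanSpace ℂ (Fin d)) :
    ∑ x, inner ℂ (b x) φ • outer (b x) u = outer φ u := by
  conv_rhs => rw [← b.sum_repr' φ, outer_sum_left]
  simp only [outer_smul_left]

theorem sum_inner_smul_outer_right (φ u : EuclideanSpace ℂ (Fin d)) :
    ∑ x, inner ℂ φ (b x) • outer u (b x) = outer u φ := by
  conv_rhs => rw [← b.sum_repr' φ, outer_sum_right]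
  simp only [outer_smul_right, Complex.star_def, inner_conj_symm]

theorem sum_ketbra_guessVector_left (a s : ℝ) {φ : EuclideanSpace ℂ (Fin d)} (hφ : ‖φ‖ = 1)
    (j : Fin d) :
    ∑ x, ketbra (guessVector b a s φ x j) =
      ((a ^ 2 * ‖inner ℂ (b j) φ‖ ^ 2 : ℝ) : ℂ) • 1 + ((s ^ 2 : ℝ) : ℂ) • ketbra (b j)
      - ((a * s : ℝ) : ℂ) •
        (inner ℂ (b j) φ • outer (b j) φ + inner ℂ φ (b j) • outer φ (b j)) := by
  have h1 : ∑ x, ‖inner ℂ (b x) φ‖ ^ 2 = 1 := by rw [b.sum_sq_norm_inner_right, hφ, one_pow]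
  simp only [ketbra_guessVector, Finset.sum_sub_distrib, Finset.sum_add_distrib,
    ← Finset.smul_sum, ← Finset.sum_smul, mul_smul, sum_inner_smul_outer_left,
    sum_inner_smul_outer_right, sum_ketbra, ← Complex.ofReal_sum, ← Finset.mul_sum, h1, mul_one]
  module

theorem sum_ketbra_guessVector_right (a s : ℝ) {φ : EuclideanSpace ℂ (Fin d)} (hφ : ‖φ‖ = 1)
    (x : Fin d) :
    ∑ j, ketbra (guessVector b a s φ x j) =
      ((a ^ 2 : ℝ) : ℂ) • ketbra (b x) + ((s ^ 2 * ‖inner ℂ (b x) φ‖ ^ 2 : ℝ) : ℂ) • 1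
      - ((a * s : ℝ) : ℂ) •
        (inner ℂ (b x) φ • outer (b x) φ + inner ℂ φ (b x) • outer φ (b x)) := by
  have h1 : ∑ x, ‖inner ℂ (b x) φ‖ ^ 2 = 1 := by rw [b.sum_sq_norm_inner_right, hφ, one_pow]
  have h2 : ∀ x j, (inner ℂ φ (b j) * inner ℂ (b x) φ) • outer (b x) (b j) =
      inner ℂ (b x) φ • inner ℂ φ (b j) • outer (b x) (b j) := fun x j => by
    rw [smul_smul, mul_comm]
  have h3 : ∀ x j, (inner ℂ (b j) φ * inner ℂ φ (b x)) • outer (b j) (b x) =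
      inner ℂ φ (b x) • inner ℂ (b j) φ • outer (b j) (b x) := fun x j => by
    rw [smul_smul, mul_comm]
  simp only [ketbra_guessVector, h2, h3, Finset.sum_sub_distrib, Finset.sum_add_distrib,
    ← Finset.smul_sum, ← Finset.sum_smul, sum_inner_smul_outer_left,
    sum_inner_smul_outer_right, sum_ketbra, ← Complex.ofReal_sum, ← Finset.mul_sum, h1, mul_one]
  module

theorem inner_basis_sub_component (φ : EuclideanSpace ℂ (Fin d)) (j : Fin d) :
    inner ℂ (b j) (φ - inner ℂ (b j) φ • b j) = 0 := by
  rw [inner_sub_right, inner_smul_right, inner_self_eq_norm_sq_to_K, b.norm_eq_one]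
  simp

/-- With `S_j = s 𝟙 + (a - s) |j⟩⟨j|`, the square root of the `j`-th element of the noisy
measurement, the first summand is `S_j |φ⟩⟨φ| S_j`. Both summands are positive semidefinite, the
second one by `posSemidef_norm_sq_smul_one_sub_ketbra`. -/
theorem guessDecomposition_self (a s : ℝ) (φ : EuclideanSpace ℂ (Fin d)) (hφ : ‖φ‖ = 1)
    (j : Fin d) :
    guessDecomposition b a s φ j j =
      ketbra ((s : ℂ) • φ + ((a - s : ℝ) * inner ℂ (b j) φ) • b j) +
        ((s ^ 2 : ℝ) : ℂ) • (((‖φ - inner ℂ (b j) φ • b j‖ ^ 2 : ℝ) : ℂ) • (1 - ketbra (b j)) -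
          ketbra (φ - inner ℂ (b j) φ • b j)) := by
  have hr : ((‖φ - inner ℂ (b j) φ • b j‖ ^ 2 : ℝ) : ℂ) =
      1 - inner ℂ φ (b j) * inner ℂ (b j) φ := by
    have h : ((‖φ - inner ℂ (b j) φ • b j‖ ^ 2 : ℝ) : ℂ) =
        inner ℂ (φ - inner ℂ (b j) φ • b j) (φ - inner ℂ (b j) φ • b j) := by
      rw [inner_self_eq_norm_sq_to_K]; norm_cast
    have h1 : inner ℂ φ φ = (1 : ℂ) := by rw [inner_self_eq_norm_sq_to_K, hφ]; simp
    have h2 : inner ℂ (b j) (b j) = (1 : ℂ) := by simp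
    rw [h, inner_sub_left, inner_sub_right, inner_sub_right, inner_smul_left, inner_smul_right,
      inner_smul_right, inner_smul_left, inner_conj_symm, h1, h2]
    ring
  rw [hr, guessDecomposition, if_pos rfl, guessCorrection, ketbra_guessVector]
  simp only [Complex.ofReal_mul, Complex.ofReal_sub, Complex.ofReal_one, ← inner_mul_inner_comm,
    ketbra_eq_outer, outer_sub_left, outer_sub_right, outer_add_left, outer_add_right,
    outer_smul_left, outer_smul_right, star_mul', star_sub, Complex.star_def, inner_conj_symm,
    Complex.conj_ofReal]
  match_scalars <;> ring

theorem guessDecomposition_posSemidef (a s : ℝ) (φ : EuclideanSpace ℂ (Fin d)) (hφ : ‖φ‖ = 1)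
    (x j : Fin d) : (guessDecomposition b a s φ x j).PosSemidef := by
  by_cases hxj : x = j
  · subst hxj
    rw [guessDecomposition_self b a s φ hφ]
    refine (ketbra_posSemidef _).add (PosSemidef.smul ?_ (by exact_mod_cast sq_nonneg s))
    exact posSemidef_norm_sq_smul_one_sub_ketbra _ _ (b.norm_eq_one x)
      (inner_basis_sub_component b φ x)
  · rw [guessDecomposition, if_neg hxj, add_zero]
    exact ketbra_posSemidef _

theorem isDecomposition_guessDecomposition {ε : ℝ} (hε : ε ∈ Set.Ioo (0 : ℝ) 1) {a s : ℝ}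
    (hs : s ^ 2 = ε / d) (ha : a ^ 2 = 1 - ε + ε / d) (φ : EuclideanSpace ℂ (Fin d))
    (hφ : ‖φ‖ = 1) :
    IsDecomposition (noisyProjective b ε hε) (guessDecomposition b a s φ) where
  posSemidef := guessDecomposition_posSemidef b a s φ hφ
  subnormalized j := by
    obtain ⟨c, hc⟩ : ∃ c : ℂ, ∑ x, guessDecomposition b a s φ x j = c • 1 := by
      refine ⟨((a ^ 2 * ‖inner ℂ (b j) φ‖ ^ 2 + s ^ 2 * (1 - ‖inner ℂ (b j) φ‖ ^ 2) : ℝ) : ℂ), ?_⟩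
      simp only [guessDecomposition, Finset.sum_add_distrib, sum_ketbra_guessVector_left b a s hφ,
        Finset.sum_ite_eq', Finset.mem_univ, if_true, guessCorrection, Complex.ofReal_add]
      module
    rw [← Finset.smul_sum, ← trace_sum, hc, trace_smul, trace_one, smul_smul, smul_eq_mul,
      mul_comm]
  sum_eq x := by
    simp only [guessDecomposition, Finset.sum_add_distrib, sum_ketbra_guessVector_right b a s hφ,
      Finset.sum_ite_eq, Finset.mem_univ, if_true, guessCorrection,
      noisyProjective_elem b hε hs ha]
    match_scalars <;> ring

/-- The left-hand side is `⟨φ|S_j|φ⟩²`, the contribution of `S_j |φ⟩⟨φ| S_j` to `⟨φ|K_{j,j}|φ⟩`. -/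
theorem expectation_guessDecomposition (a s : ℝ) (φ : EuclideanSpace ℂ (Fin d)) (hφ : ‖φ‖ = 1)
    (j : Fin d) :
    (s + (a - s) * ‖inner ℂ (b j) φ‖ ^ 2) ^ 2 ≤ expectation φ (guessDecomposition b a s φ j j) := by
  rw [guessDecomposition_self b a s φ hφ, expectation_add]
  have h1 : 0 ≤ expectation φ (((s ^ 2 : ℝ) : ℂ) •
      (((‖φ - inner ℂ (b j) φ • b j‖ ^ 2 : ℝ) : ℂ) • (1 - ketbra (b j)) -
          ketbra (φ - inner ℂ (b j) φ • b j))) :=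
    expectation_nonneg φ (PosSemidef.smul (posSemidef_norm_sq_smul_one_sub_ketbra _ _
      (b.norm_eq_one j) (inner_basis_sub_component b φ j))
      (by exact_mod_cast sq_nonneg s))
  have h2 : inner ℂ ((s : ℂ) • φ + ((a - s : ℝ) * inner ℂ (b j) φ) • b j) φ =
      ((s + (a - s) * ‖inner ℂ (b j) φ‖ ^ 2 : ℝ) : ℂ) := by
    rw [inner_add_left, inner_smul_left, inner_smul_left, inner_self_eq_norm_sq_to_K, hφ, map_mul,
      inner_conj_symm, mul_assoc, inner_mul_inner_comm]
    simp
  have h3 : expectation φ (ketbra ((s : ℂ) • φ + ((a - s : ℝ) * inner ℂ (b j) φ) • b j)) =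
      (s + (a - s) * ‖inner ℂ (b j) φ‖ ^ 2) ^ 2 := by
    rw [expectation_ketbra, h2, Complex.norm_real, Real.norm_eq_abs, sq_abs]
  rw [h3]
  linarith

/-- The numbers `⟨φ|S_j|φ⟩` add up to `a + (d - 1) s` for every unit vector `φ`, so that the
sum of their squares is smallest when they are all equal. -/
theorem exists_le_guessValue {ε : ℝ} (hε : ε ∈ Set.Ioo (0 : ℝ) 1) {a s : ℝ} (hd : 0 < d)
    (hs : s ^ 2 = ε / d) (ha : a ^ 2 = 1 - ε + ε / d) (φ : EuclideanSpace ℂ (Fin d))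
    (hφ : ‖φ‖ = 1) :
    ∃ p ∈ guessValues φ (noisyProjective b ε hε), 1 / (d : ℝ) * (a + (d - 1) * s) ^ 2 ≤ p := by
  refine ⟨_, ⟨_, isDecomposition_guessDecomposition b hε hs ha φ hφ, rfl⟩, ?_⟩
  refine le_trans ?_ (Finset.sum_le_sum fun j _ => expectation_guessDecomposition b a s φ hφ j)
  have hsum : ∑ j, (s + (a - s) * ‖inner ℂ (b j) φ‖ ^ 2) = a + (d - 1) * s := by
    rw [Finset.sum_add_distrib, ← Finset.mul_sum, b.sum_sq_norm_inner_right, hφ]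
    simp
    ring
  have hcs := sq_sum_le_card_mul_sum_sq (s := Finset.univ)
    (f := fun j => s + (a - s) * ‖inner ℂ (b j) φ‖ ^ 2)
  rw [hsum, Finset.card_univ, Fintype.card_fin] at hcs
  rw [one_div, inv_mul_le_iff₀ (by exact_mod_cast hd)]
  exact hcs

/-! ### The guessing probability of the uniform superposition -/

theorem norm_smul_sum_add_smul_sq (α β : ℝ) (j : Fin d) :
    ‖(α : ℂ) • ∑ x, b x + (β : ℂ) • b j‖ ^ 2 = d * α ^ 2 + 2 * α * β + β ^ 2 := by
  have hx : ∀ x, ‖inner ℂ (b x) ((α : ℂ) • ∑ x, b x + (β : ℂ) • b j)‖ ^ 2 =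
      α ^ 2 + if x = j then 2 * α * β + β ^ 2 else 0 := fun x => by
    rw [inner_add_right, inner_smul_right, inner_smul_right, inner_sum]
    simp only [b.inner_eq_ite, Finset.sum_ite_eq, Finset.mem_univ, if_true]
    split_ifs
    · rw [mul_one, mul_one, ← Complex.ofReal_add, Complex.norm_real, Real.norm_eq_abs, sq_abs]
      ring
    · simp
  rw [← b.sum_sq_norm_inner_right, Finset.sum_congr rfl fun x _ => hx x, Finset.sum_add_distrib]
  simp
  ring

theorem inner_smul_sum_add_smul (α β : ℝ) (j : Fin d) :
    inner ℂ (b j) ((α : ℂ) • ∑ x, b x + (β : ℂ) • b j) = ((α + β : ℝ) : ℂ) := by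
  rw [inner_add_right, inner_smul_right, inner_smul_right, inner_sum]
  simp [b.inner_eq_ite]

theorem norm_uniformState (hd : 0 < d) : ‖uniformState b‖ = 1 := by
  have hd' : (0 : ℝ) < d := by exact_mod_cast hd
  have h := norm_smul_sum_add_smul_sq b (√d)⁻¹ 0 ⟨0, hd⟩
  rw [Complex.ofReal_zero, zero_smul, add_zero, inv_pow, Real.sq_sqrt hd'.le,
    mul_inv_cancel₀ hd'.ne'] at h
  have h2 : ‖uniformState b‖ ^ 2 = 1 := by
    rw [uniformState, h]
    ring
  exact (pow_eq_one_iff_of_nonneg (norm_nonneg _) two_ne_zero).1 h2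

/-- With `u = ∑_x |x⟩`, `e_j = S_j u` and `g_j = (a + s) u - e_j`, the quadratic form of `K_{j,j}`
at `e_j` is bounded by `K_{j,j} ≤ ∑_x K_{x,j} = p_j 𝟙`, that at `g_j` by `K_{j,j} ≤ M_j`, and `e_j`,
`g_j` are combined into `(a + s) u` by `expectation_add_le`. -/
theorem guessValue_uniformState_le {ε : ℝ} (hε : ε ∈ Set.Ioo (0 : ℝ) 1) {a s : ℝ} (hd : 0 < d)
    (hs0 : 0 < s) (hsa : s ≤ a) (hs : s ^ 2 = ε / d) (ha : a ^ 2 = 1 - ε + ε / d)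
    {K : Fin d → Fin d → Matrix (Fin d) (Fin d) ℂ}
    (hK : IsDecomposition (noisyProjective b ε hε) K) :
    ∑ j, expectation (uniformState b) (K j j) ≤ 1 / (d : ℝ) * (a + (d - 1) * s) ^ 2 := by
  have hd' : (0 : ℝ) < d := by exact_mod_cast hd
  have : Nonempty (Fin d) := ⟨⟨0, hd⟩⟩
  have has : a ^ 2 + (d - 1) * s ^ 2 = 1 := by
    rw [hs, ha]; field_simp; ring
  have ha0 : 0 < a := hs0.trans_le hsa
  obtain ⟨p, hp, hp1⟩ := hK.exists_weights
  set e : Fin d → EuclideanSpace ℂ (Fin d) := fun j =>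
    (s : ℂ) • ∑ x, b x + ((a - s : ℝ) : ℂ) • b j with he
  set g : Fin d → EuclideanSpace ℂ (Fin d) := fun j =>
    (a : ℂ) • ∑ x, b x + ((s - a : ℝ) : ℂ) • b j with hg
  have heg : ∀ j, e j + g j = ((a + s : ℝ) : ℂ) • ∑ x, b x := fun j => by
    simp only [he, hg]
    match_scalars <;> ring
  have hqe : ∀ j, expectation (e j) (K j j) ≤ p j := fun j => by
    have hle : 0 ≤ expectation (e j) (∑ x, K x j - K j j) :=
      expectation_nonneg _ (le_iff.1 (Finset.single_le_sum
        (f := fun x => K x j) (fun y _ => nonneg_iff_posSemidef.2 (hK.posSemidef y j))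
        (Finset.mem_univ j)))
    rw [expectation_sub, hp, expectation_smul, expectation_one, norm_smul_sum_add_smul_sq] at hle
    have h1 : d * s ^ 2 + 2 * s * (a - s) + (a - s) ^ 2 = 1 := by rw [← has]; ring
    rw [h1] at hle
    linarith
  have hqg : ∀ j, expectation (g j) (K j j) ≤ d * a ^ 2 * s ^ 2 := fun j => by
    have hle : 0 ≤ expectation (g j) ((noisyProjective b ε hε).elem j - K j j) :=
      expectation_nonneg _ (le_iff.1 (hK.le_elem j j))
    rw [expectation_sub, noisyProjective_elem b hε hs ha, expectation_add, expectation_smul,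
      expectation_smul, expectation_one, expectation_ketbra, norm_smul_sum_add_smul_sq,
      inner_smul_sum_add_smul, Complex.norm_real, Real.norm_eq_abs, sq_abs] at hle
    linarith
  -- the two terms on the right of `expectation_add_le`, summed over `j`, are at most `τ (1 + τ)`
  -- and `(1 + τ) (a s d)²`; this weight minimizes their sum divided by `τ`
  set τ : ℝ := a * s * d with hτ
  have hτ0 : 0 < τ := by positivity
  have hj : ∀ j, τ * ((a + s) ^ 2 * (d * expectation (uniformState b) (K j j))) ≤
      τ * (1 + τ) * p j + (1 + τ) * (d * a ^ 2 * s ^ 2) := fun j => by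
    have hu : (a + s) ^ 2 * (d * expectation (uniformState b) (K j j)) =
        expectation (e j + g j) (K j j) := by
      rw [heg, expectation_smul_left, uniformState, expectation_smul_left, inv_pow,
        Real.sq_sqrt hd'.le, mul_inv_cancel_left₀ hd'.ne']
    rw [hu]
    refine (expectation_add_le (e j) (g j) (hK.posSemidef j j) τ).trans ?_
    gcongr
    · exact hqe j
    · exact hqg j
  have hsum := Finset.sum_le_sum fun j (_ : j ∈ Finset.univ) => hj j
  simp only [Finset.sum_add_distrib, ← Finset.mul_sum, hp1, Finset.sum_const, Finset.card_univ,
    Fintype.card_fin, nsmul_eq_mul] at hsum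
  have hfac : 1 + τ = (a + (d - 1) * s) * (a + s) := by
    rw [hτ]
    linear_combination -has
  have hrhs : τ * (1 + τ) * 1 + (1 + τ) * (d * a ^ 2 * (d * s ^ 2)) =
      τ * ((a + s) ^ 2 * (a + (d - 1) * s) ^ 2) := by
    calc _ = τ * (1 + τ) ^ 2 := by rw [hτ]; ring
      _ = _ := by rw [hfac]; ring
  rw [hrhs] at hsum
  have h1 := le_of_mul_le_mul_left (le_of_mul_le_mul_left hsum hτ0) (by positivity)
  rw [one_div, le_inv_mul_iff₀ hd']
  exact h1

end NoisyProjective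

/-- `CFC.sqrt` is the positive semidefinite square root; its trace is real. The first clause says
that the supremum in `pGuess` is a maximum, the second one that the infimum in `pGuessStar` is a
minimum. -/
theorem theorem2 (d : ℕ) (b : OrthonormalBasis (Fin d) ℂ (EuclideanSpace ℂ (Fin d)))
    (ε : ℝ) (hε : ε ∈ Set.Ioo (0 : ℝ) 1) (k : Fin d) :
    (∀ φ : EuclideanSpace ℂ (Fin d), ‖φ‖ = 1 →
      IsGreatest (guessValues φ (noisyProjective b ε hε)) (pGuess φ (noisyProjective b ε hε))) ∧
    IsLeast (stateGuessValues (noisyProjective b ε hε)) (pGuessStar (noisyProjective b ε hε)) ∧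
    pGuessStar (noisyProjective b ε hε) =
      1 / (d : ℝ) * (CFC.sqrt ((noisyProjective b ε hε).elem k)).trace.re ^ 2 ∧
    ‖uniformState b‖ = 1 ∧
    pGuess (uniformState b) (noisyProjective b ε hε) =
      pGuessStar (noisyProjective b ε hε) := by
  have hd : 0 < d := k.pos
  have hd' : (0 : ℝ) < d := by exact_mod_cast hd
  have hquot : 0 < ε / d := div_pos hε.1 hd'
  have hs : √(ε / d) ^ 2 = ε / d := Real.sq_sqrt hquot.le
  have ha : √(1 - ε + ε / d) ^ 2 = 1 - ε + ε / d := Real.sq_sqrt (by linarith [hε.2])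
  have hs0 : 0 < √(ε / d) := Real.sqrt_pos.2 hquot
  have hsa : √(ε / d) ≤ √(1 - ε + ε / d) := Real.sqrt_le_sqrt (by linarith [hε.2])
  have hmax : ∀ φ : EuclideanSpace ℂ (Fin d), ‖φ‖ = 1 →
      IsGreatest (guessValues φ (noisyProjective b ε hε)) (pGuess φ (noisyProjective b ε hε)) :=
    fun φ hφ => isGreatest_pGuess φ ⟨_, isDecomposition_guessDecomposition b hε hs ha φ hφ⟩
  rw [trace_sqrt_noisyProjective_elem b hε hs0.le hsa hs ha]
  set G := 1 / (d : ℝ) * (√(1 - ε + ε / d) + (d - 1) * √(ε / d)) ^ 2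
  have hlower : ∀ φ : EuclideanSpace ℂ (Fin d), ‖φ‖ = 1 →
      G ≤ pGuess φ (noisyProjective b ε hε) := fun φ hφ => by
    obtain ⟨p, hp, hGp⟩ := exists_le_guessValue b hε hd hs ha φ hφ
    exact hGp.trans ((hmax φ hφ).2 hp)
  have hu := norm_uniformState b hd
  have hunif : pGuess (uniformState b) (noisyProjective b ε hε) = G := by
    refine le_antisymm ?_ (hlower _ hu)
    obtain ⟨K, hK, hval⟩ := (hmax _ hu).1
    rw [hval]
    exact guessValue_uniformState_le b hε hd hs0 hsa hs ha hK
  have hleast : IsLeast (stateGuessValues (noisyProjective b ε hε)) G := by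
    refine ⟨⟨uniformState b, hu, hunif.symm⟩, ?_⟩
    rintro _ ⟨φ, hφ, rfl⟩
    exact hlower φ hφ
  have hstar : pGuessStar (noisyProjective b ε hε) = G := hleast.csInf_eq
  exact ⟨hmax, hstar ▸ hleast, hstar, hu, hunif.trans hstar.symm⟩
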